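/- For a finite set $E$ and a family $\mathcal{L}\subseteq 2^E$, the toggle $t_e:\mathcal{L}\to\mathcal{L}$ ($e\in E$) sends $X$ to $X\cup\{e\}$ if $e\notin X$ and $X\cup\{e\}\in\mathcal{L}$, to $X\setminus\{e\}$ if $e\in X$ and $X\setminus\{e\}\in\mathcal{L}$, and to $X$ otherwise. The toggle group $T(\mathcal{L})$ is the subgroup of the symmetric group $\mathfrak{S}_{\mathcal{L}}$ generated by the toggles, and $\mathcal{L}$ is called toggle-alternating if $T(\mathcal{L})$ contains the alternating group $A_{\mathcal{L}}$. For a finite poset $P$, let $\mathcal{IC}(P)\subseteq 2^P$ be the family of interval-closed sets, i.e. of those $I\subseteq P$ such that $x,y\in I$ and $x\le z\le y$ imply $z\in I$. An element $m\in P$ is extremal-atomic if it is maximal and covers only minimal elements, or is minimal and is covered only by maximal elements. Say that $P$ is strongly-extremal-atomic-free if there are $n\ge 0$ and elements $p_1,\dots,p_n$ of $P$ such that, with the induced subposets $P_0=P$ and $P_i=P_{i-1}\setminus\{p_i\}$, the poset $P_n$ is a chain with at least three elements, $p_{i+1}$ is a maximal or minimal element of $P_i$ for $0\le i\le n-1$,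 and each $P_i$ ($0\le i\le n$) has connected Hasse diagram and no extremal-atomic element. Let $P$ be a finite poset. 1. If $P$ is the disjoint union $P=P_1+P_2$ of two posets, then $T(\mathcal{IC}(P))\cong T(\mathcal{IC}(P_1))\times T(\mathcal{IC}(P_2))$, by an isomorphism that sends $t_p$ to $(t_p,1)$ for $p\in P_1$ and to $(1,t_p)$ for $p\in P_2$. 2. If $m\in P$ is extremal-atomic, then $T(\mathcal{IC}(P))\cong T(\mathcal{IC}(P\setminus\{m\}))\times T(\mathcal{IC}(\{m\}))\cong T(\mathcal{IC}(P\setminus\{m\}))\times\mathfrak{S}_2$, where the first isomorphism can be chosen to send $t_p$ to $(t_p,1)$ for $p\ne m$ and $t_m$ to $(1,t_m)$. 3. If $P$ has only two ranks, i.e. if there is a function $\rho:P\to\mathbb{Z}$ with at most two values and with $\rho(y)=\rho(x)+1$ whenever $y$ covers $x$, then $T(\mathcal{IC}(P))\cong(\mathfrak{S}_2)^{|P|}$. 4. If $P$ is strongly-extremal-atomic-free, then $\mathcal{IC}(P)$ is toggle-alternating. -/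

import Mathlib

universe u v w

section GeneralizedToggle

variable {E : Type u}

open Classical in
/-- The toggle of `e` relative to a family `L` of subsets of `E`, as a map on subsets: add `e` if
this gives a member of `L`, remove `e` if this gives a member of `L`, and do nothing otherwise. -/
noncomputable def toggleSet (L : Set (Set E)) (e : E) (X : Set E) : Set E :=
  if e ∉ X ∧ X ∪ {e} ∈ L then X ∪ {e}
  else if e ∈ X ∧ X \ {e} ∈ L then X \ {e}
  else X

theorem toggleSet_mem (L : Set (Set E)) (e : E) {X : Set E} (hX : X ∈ L) :
    toggleSet L e X ∈ L := by
  unfold toggleSet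
  split_ifs with h1 h2
  · exact h1.2
  · exact h2.2
  · exact hX

theorem toggleSet_toggleSet (L : Set (Set E)) (e : E) {X : Set E} (hX : X ∈ L) :
    toggleSet L e (toggleSet L e X) = X := by
  by_cases he : e ∈ X
  · by_cases h : X \ {e} ∈ L
    · have h1 : toggleSet L e X = X \ {e} := by simp [toggleSet, he, h]
      have h2 : X \ {e} ∪ {e} = X := by simpa using he
      rw [h1]
      unfold toggleSet
      rw [h2]
      simp [hX]
    · have h1 : toggleSet L e X = X := by simp [toggleSet, he, h]
      rw [h1, h1]
  · by_cases h : X ∪ {e} ∈ L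
    · have h1 : toggleSet L e X = X ∪ {e} := by
        unfold toggleSet
        rw [if_pos ⟨he, h⟩]
      have h2 : (X ∪ {e}) \ {e} = X := by
        ext x
        by_cases hx : x = e
        · subst hx; simp [he]
        · simp [hx]
      rw [h1]
      unfold toggleSet
      rw [h2]
      simp [hX]
    · have h1 : toggleSet L e X = X := by
        unfold toggleSet
        rw [if_neg (fun H => h H.2), if_neg (fun H => he H.1)]
      rw [h1, h1]

/-- The toggle `t_e : L → L`, an involutive permutation of the family `L`. -/
noncomputable def toggle (L : Set (Set E)) (e : E) : Equiv.Perm L where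
  toFun X := ⟨toggleSet L e X, toggleSet_mem L e X.2⟩
  invFun X := ⟨toggleSet L e X, toggleSet_mem L e X.2⟩
  left_inv X := Subtype.ext (toggleSet_toggleSet L e X.2)
  right_inv X := Subtype.ext (toggleSet_toggleSet L e X.2)

/-- The toggle group `T(L)`: the subgroup of the symmetric group on `L` generated by the toggles. -/
def toggleGroup (L : Set (Set E)) : Subgroup (Equiv.Perm L) :=
  Subgroup.closure (Set.range (toggle L))

/-- The toggle `t_e` as an element of the toggle group `T(L)`. -/
noncomputable def toggleGen (L : Set (Set E)) (e : E) : toggleGroup L :=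
  ⟨toggle L e, Subgroup.subset_closure (Set.mem_range_self e)⟩

open Classical in
/-- `L` is toggle-alternating if `T(L)` contains the alternating group on `L`. -/
def ToggleAlternating [Finite E] (L : Set (Set E)) : Prop :=
  letI : Fintype L := Fintype.ofFinite L
  alternatingGroup L ≤ toggleGroup L

end GeneralizedToggle

section IntervalClosed

/-- The interval-closed sets of a poset: if `x, y ∈ I` and `x ≤ z ≤ y` then `z ∈ I`. -/
def intervalClosedSets (P : Type u) [PartialOrder P] : Set (Set P) :=
  {I | I.OrdConnected}

variable {P : Type u} [PartialOrder P]

/-- `m` is maximal and covers only minimal elements, or `m` is minimal and is covered only by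
maximal elements. -/
def IsExtremalAtomic (m : P) : Prop :=
  (IsMax m ∧ ∀ x, x ⋖ m → IsMin x) ∨ (IsMin m ∧ ∀ x, m ⋖ x → IsMax x)

/-- The subposets `P_0 = P`, `P_{i+1} = P_i \ {p_{i+1}}`. The sequence is indexed from `0` here, so
`p i` is the element that is removed from `P_i`. -/
def remainingSubposet (p : ℕ → P) : ℕ → Set P
  | 0 => Set.univ
  | i + 1 => remainingSubposet p i \ {p i}

variable (P)

/-- One can remove from `P` elements `p 0, …, p (n - 1)`, each maximal or minimal in what remains,
so that a chain with at least three elements is left, and so that every poset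
`P_0, …, P_n` on the way has connected Hasse diagram and no extremal-atomic element.
(The values `p i` for `i ≥ n` play no role.) -/
def IsStronglyExtremalAtomicFree : Prop :=
  ∃ (n : ℕ) (p : ℕ → P),
    IsChain (· ≤ ·) (remainingSubposet p n) ∧
    3 ≤ (remainingSubposet p n).encard ∧
    (∀ i < n, Maximal (· ∈ remainingSubposet p i) (p i) ∨
      Minimal (· ∈ remainingSubposet p i) (p i)) ∧
    ∀ i ≤ n, (SimpleGraph.hasse (remainingSubposet p i)).Connected ∧
      ∀ m : remainingSubposet p i, ¬ IsExtremalAtomic m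

/-- `P` is graded, by a rank function that takes at most two values. -/
def HasOnlyTwoRanks : Prop :=
  ∃ ρ : P → ℤ, (∀ x y, x ⋖ y → ρ y = ρ x + 1) ∧ (Set.range ρ).encard ≤ 2

end IntervalClosed

/-!
The family of interval-closed sets is determined by the three-element chains of the poset. No such
chain meets both summands of a disjoint union or contains an extremal-atomic element, so in both
cases the family is a product of two families, and the toggles act on the factors separately. When
there is no three-element chain at all, every subset is interval-closed and the toggles are the
coordinate flips of the cube.

For the last part, restore the removed elements one at a time, starting from the chain. Let `p` be a
maximal or minimal element that is not extremal-atomic. The interval-closed sets avoiding `p` are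
those of the poset without `p`, and they outnumber those containing `p`: removing `p` is injective
and never produces `{x}`, where `p` is an end of a chain `x, z, p`. By induction the toggle group
induces every even permutation of the sets avoiding `p`. As an alternating group is simple and here
larger than the symmetric group on the remaining sets, Goursat's argument shows that the toggle
group contains the even permutations of the sets avoiding `p` that fix all other sets. Since the
toggle group is transitive and the sets avoiding `p` are in the majority, it is primitive, and
Jordan's theorem on primitive groups containing a three-cycle applies. For the chain `a < b < c`
with its seven interval-closed sets, transitivity already implies primitivity because seven is
prime, and the commutator of the toggles of `a` and `c` is a three-cycle on `∅`, `{a}`, `{c}`.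
-/

section PermutationGroups

open Equiv MulAction
open scoped commutatorElement

-- Goursat: the members of `A` that lie in `G` alone, with trivial second component, form a normal
-- subgroup of `A`. If it were trivial, then `A` would embed in `M`.
theorem le_comap_inl_of_le_map_fst {K M : Type*} [Group K] [Group M] [Finite M] {A : Subgroup K}
    [IsSimpleGroup A] (hcard : Nat.card M < Nat.card A) {G : Subgroup (K × M)}
    (hA : A ≤ G.map (MonoidHom.fst K M)) : A ≤ G.comap (MonoidHom.inl K M) := by
  have lift : ∀ a : A, ∃ m : M, ((a : K), m) ∈ G := fun a => by
    obtain ⟨⟨_, m⟩, hm, rfl⟩ := hA a.2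
    exact ⟨m, hm⟩
  choose m hm using lift
  have hnormal : ((G.comap (MonoidHom.inl K M)).subgroupOf A).Normal := by
    refine ⟨fun n hn a => ?_⟩
    have hconj := G.mul_mem (G.mul_mem (hm a) hn) (G.inv_mem (hm a))
    simpa [Subgroup.mem_subgroupOf] using hconj
  rcases hnormal.eq_bot_or_eq_top with hbot | htop
  · have hinj : Function.Injective m := by
      intro a b hab
      have hdiv := G.mul_mem (hm a) (G.inv_mem (hm b))
      have hmem : a * b⁻¹ ∈ (G.comap (MonoidHom.inl K M)).subgroupOf A := by
        simpa [Subgroup.mem_subgroupOf, hab] using hdiv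
      rw [hbot, Subgroup.mem_bot] at hmem
      exact mul_inv_eq_one.mp hmem
    exact absurd (Nat.card_le_card_of_injective m hinj) hcard.not_ge
  · exact Subgroup.subgroupOf_eq_top.mp htop

theorem card_perm_lt_card_alternatingGroup {X Z : Type*} [Fintype X] [DecidableEq X] [Finite Z]
    (hX : 3 ≤ Nat.card X) (hZX : Nat.card Z < Nat.card X) :
    Nat.card (Perm Z) < Nat.card (alternatingGroup X) := by
  have : Nontrivial X := Finite.one_lt_card_iff_nontrivial.mp (by lia)
  have htwo := two_mul_nat_card_alternatingGroup (α := X)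
  obtain ⟨n, hn⟩ := Nat.exists_eq_succ_of_ne_zero (n := Nat.card X) (by lia)
  have hle : (Nat.card Z).factorial ≤ n.factorial := Nat.factorial_le (by lia)
  rw [Nat.card_perm, hn, Nat.succ_eq_add_one, Nat.factorial_succ] at htwo
  rw [Nat.card_perm]
  nlinarith [n.factorial_pos]

variable {Y : Type*} [Fintype Y] [DecidableEq Y] {p : Y → Prop} [DecidablePred p]
  {H : Subgroup (Perm Y)}

theorem map_ofSubtype_alternatingGroup_le (h5 : 5 ≤ Nat.card {y // p y})
    (hcard : Nat.card Y < 2 * Nat.card {y // p y})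
    (hH : ∀ g ∈ alternatingGroup {y // p y}, ∃ h ∈ H, ∀ y : {y // p y}, h y = g y) :
    (alternatingGroup {y // p y}).map Perm.ofSubtype ≤ H := by
  have := alternatingGroup.isSimpleGroup h5
  have hcompl : Nat.card {y // ¬ p y} < Nat.card {y // p y} := by
    have hsum := Nat.card_congr (sumCompl p)
    rw [Nat.card_sum] at hsum
    lia
  have hmap : alternatingGroup {y // p y} ≤
      (H.comap (Perm.subtypeCongrHom p)).map (MonoidHom.fst _ _) := by
    intro g hg
    obtain ⟨h, hh, hgh⟩ := hH g hg
    have hp : ∀ y, p (h y) ↔ p y := by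
      refine fun y => ⟨fun hy => ?_, fun hy => hgh ⟨y, hy⟩ ▸ (g ⟨y, hy⟩).2⟩
      have hy' : h (g⁻¹ ⟨h y, hy⟩ : {y // p y}) = h y := by
        rw [hgh, ← Perm.mul_apply, mul_inv_cancel, Perm.one_apply]
      exact h.injective hy' ▸ (g⁻¹ ⟨h y, hy⟩).2
    refine ⟨(h.subtypePerm hp, h.subtypePerm fun y => not_congr (hp y)), ?_, ?_⟩
    · have hsplit : Perm.subtypeCongrHom p
          (h.subtypePerm hp, h.subtypePerm fun y => not_congr (hp y)) = h := by
        ext y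
        by_cases hy : p y <;> simp [hy]
      rwa [SetLike.mem_coe, Subgroup.mem_comap, hsplit]
    · ext y
      exact hgh y
  rintro _ ⟨g, hg, rfl⟩
  have hext : Perm.subtypeCongr g 1 = Perm.ofSubtype g := by
    ext y
    by_cases hy : p y <;>
      simp [hy, Perm.ofSubtype_apply_of_mem, Perm.ofSubtype_apply_of_not_mem]
  exact hext ▸ le_comap_inl_of_le_map_fst
    (card_perm_lt_card_alternatingGroup (by lia) hcompl) hmap hg

theorem alternatingGroup_le_of_map_ofSubtype_le [IsPretransitive H Y]
    (h3 : 3 ≤ Nat.card {y // p y}) (hcard : Nat.card Y < 2 * Nat.card {y // p y})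
    (hH : (alternatingGroup {y // p y}).map Perm.ofSubtype ≤ H) : alternatingGroup Y ≤ H := by
  have hprim : IsPreprimitive H Y := by
    have := alternatingGroup.isPreprimitive_of_three_le_card {y // p y} h3
    let extend : alternatingGroup {y // p y} →* H :=
      (Perm.ofSubtype.comp (Subgroup.subtype _)).codRestrict H fun g => hH ⟨g, g.2, rfl⟩
    let incl : {y // p y} →ₑ[extend] Y :=
      { toFun := Subtype.val, map_smul' := fun g y => (Perm.ofSubtype_apply_coe g.1 y).symm }
    refine IsPreprimitive.of_card_lt (f := incl) ?_
    have hrange : (Set.range incl).ncard = Nat.card {y // p y} :=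
      Set.ncard_range_of_injective Subtype.val_injective
    lia
  obtain ⟨x, y, z, hxy, hxz, hyz⟩ : ∃ x y z : {y // p y}, x ≠ y ∧ x ≠ z ∧ y ≠ z := by
    rw [← Fintype.two_lt_card_iff, ← Nat.card_eq_fintype_card]
    lia
  have hcycle := Perm.isThreeCycle_swap_mul_swap_same hxy hxz hyz
  refine Perm.alternatingGroup_le_of_isPreprimitive_of_isThreeCycle_mem hprim
    (g := Perm.ofSubtype (swap x y * swap x z)) ?_ (hH ⟨_, hcycle.mem_alternatingGroup, rfl⟩)
  rw [Perm.IsThreeCycle, Perm.cycleType_ofSubtype]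
  exact hcycle

theorem isThreeCycle_commutator {s t : Perm Y} {x y z : Y} (hxy : x ≠ y) (hxz : x ≠ z)
    (hyz : y ≠ z) (hsx : s x = y) (hsy : s y = x) (hsz : s z = z) (htx : t x = z) (hty : t y = y)
    (htz : t z = x) (hcomm : ∀ w, w ≠ x → w ≠ y → w ≠ z → s (t w) = t (s w)) :
    Perm.IsThreeCycle ⁅s, t⁆ := by
  have hcommutator : ⁅s, t⁆ = swap x z * swap x y := by
    rw [commutatorElement_def, mul_inv_eq_iff_eq_mul, mul_inv_eq_iff_eq_mul]
    ext w
    simp only [Perm.mul_apply]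
    by_cases hw : w = x ∨ w = y ∨ w = z
    · rcases hw with rfl | rfl | rfl <;>
        simp [*, Ne.symm, swap_apply_of_ne_of_ne]
    · push Not at hw
      obtain ⟨hwx, hwy, hwz⟩ := hw
      have hx : t (s w) ≠ x := fun h => hwz (s.injective (t.injective (by rw [h, hsz, htz])))
      have hy : t (s w) ≠ y := fun h => hwx (s.injective (t.injective (by rw [h, hsx, hty])))
      have hz : t (s w) ≠ z := fun h => hwy (s.injective (t.injective (by rw [h, hsy, htx])))
      rw [swap_apply_of_ne_of_ne hx hy, swap_apply_of_ne_of_ne hx hz, hcomm w hwx hwy hwz]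
  rw [hcommutator]
  exact Perm.isThreeCycle_swap_mul_swap_same hxz hxy hyz.symm

end PermutationGroups

section Toggles

open Equiv
open scoped symmDiff

variable {E : Type*} {L : Set (Set E)} {e : E} {X : Set E}

theorem symmDiff_singleton_of_mem (he : e ∈ X) : X ∆ {e} = X \ {e} :=
  symmDiff_of_ge (Set.singleton_subset_iff.mpr he)

theorem symmDiff_singleton_of_notMem (he : e ∉ X) : X ∆ {e} = X ∪ {e} :=
  (Set.disjoint_singleton_right.mpr he).symmDiff_eq_sup

theorem toggleSet_of_symmDiff_mem (h : X ∆ {e} ∈ L) : toggleSet L e X = X ∆ {e} := by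
  by_cases he : e ∈ X
  · rw [symmDiff_singleton_of_mem he] at h ⊢
    simp [toggleSet, he, h]
  · rw [symmDiff_singleton_of_notMem he] at h ⊢
    exact if_pos ⟨he, h⟩

theorem toggleSet_of_symmDiff_notMem (h : X ∆ {e} ∉ L) : toggleSet L e X = X := by
  by_cases he : e ∈ X
  · rw [symmDiff_singleton_of_mem he] at h
    simp [toggleSet, he, h]
  · rw [symmDiff_singleton_of_notMem he] at h
    exact (if_neg fun h' => h h'.2).trans (if_neg fun h' => he h'.1)

theorem toggle_toggle_comm {d : E} {X : L} (hd : (X : Set E) ∆ {d} ∈ L)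
    (he : (X : Set E) ∆ {e} ∈ L) (hde : (X : Set E) ∆ {d} ∆ {e} ∈ L) :
    toggle L d (toggle L e X) = toggle L e (toggle L d X) := by
  have hed : (X : Set E) ∆ {e} ∆ {d} ∈ L := symmDiff_right_comm (X : Set E) {d} {e} ▸ hde
  refine Subtype.ext ?_
  change toggleSet L d (toggleSet L e X) = toggleSet L e (toggleSet L d X)
  rw [toggleSet_of_symmDiff_mem hd, toggleSet_of_symmDiff_mem he, toggleSet_of_symmDiff_mem hde,
    toggleSet_of_symmDiff_mem hed, symmDiff_right_comm]

theorem toggle_mem_toggleGroup (L : Set (Set E)) (e : E) : toggle L e ∈ toggleGroup L :=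
  Subgroup.subset_closure (Set.mem_range_self e)

theorem closure_range_toggleGen (L : Set (Set E)) :
    Subgroup.closure (Set.range (toggleGen L)) = ⊤ := by
  refine (congrArg Subgroup.closure ?_).trans Subgroup.closure_closure_coe_preimage
  exact Set.ext fun g => exists_congr fun e => Subtype.ext_iff

theorem exists_toggleGroup_mulEquiv {G : Type*} [Group G] {ψ : G →* Perm L}
    (hψ : Function.Injective ψ) {γ : E → G} (hγ : Subgroup.closure (Set.range γ) = ⊤)
    (hψγ : ∀ e, ψ (γ e) = toggle L e) :
    ∃ φ : toggleGroup L ≃* G, ∀ e, φ (toggleGen L e) = γ e := by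
  have hrange : ψ.range = toggleGroup L := by
    rw [MonoidHom.range_eq_map, ← hγ, MonoidHom.map_closure, ← Set.range_comp]
    exact congrArg (fun t => Subgroup.closure (Set.range t)) (funext hψγ)
  let φ := (ψ.ofInjective hψ).trans (MulEquiv.subgroupCongr hrange)
  refine ⟨φ.symm, fun e => ?_⟩
  rw [MulEquiv.symm_apply_eq]
  exact Subtype.ext (hψγ e).symm

end Toggles

section Products

open Equiv
open scoped symmDiff

theorem closure_range_sumElim_eq_top {G H ι κ : Type*} [Group G] [Group H] {γ : ι → G} {δ : κ → H}
    (hγ : Subgroup.closure (Set.range γ) = ⊤) (hδ : Subgroup.closure (Set.range δ) = ⊤) :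
    Subgroup.closure
      (Set.range (Sum.elim (fun i => (γ i, (1 : H))) fun j => ((1 : G), δ j))) = ⊤ := by
  rw [eq_top_iff, ← Subgroup.top_prod_top, Subgroup.prod_le_iff, ← hγ, ← hδ, MonoidHom.map_closure,
    MonoidHom.map_closure, ← Set.range_comp, ← Set.range_comp, Set.Sum.elim_range]
  exact ⟨Subgroup.closure_mono Set.subset_union_left, Subgroup.closure_mono Set.subset_union_right⟩

/-- The componentwise action of `Perm α × Perm β` on `α × β`, as a homomorphism into the symmetric
group. -/
def permProdHom (α β : Type*) : Perm α × Perm β →* Perm (α × β) where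
  toFun g := prodCongr g.1 g.2
  map_one' := rfl
  map_mul' _ _ := rfl

theorem permProdHom_injective (α β : Type*) [Nonempty α] [Nonempty β] :
    Function.Injective (permProdHom α β) := by
  intro g h hgh
  have hval : ∀ x y, (g.1 x, g.2 y) = (h.1 x, h.2 y) := fun x y => DFunLike.congr_fun hgh (x, y)
  inhabit α
  inhabit β
  exact Prod.ext (Equiv.ext fun x => congrArg Prod.fst (hval x default))
    (Equiv.ext fun y => congrArg Prod.snd (hval default y))

variable {E₁ E₂ E : Type*} {L₁ : Set (Set E₁)} {L₂ : Set (Set E₂)} {L : Set (Set E)}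

/-- The identification of a family `L` on a disjoint union with the product of the families `L₁` and
`L₂` on the two summands, when a set belongs to `L` iff its traces belong to `L₁` and `L₂`. The
disjoint union is encoded by a bijection `f : E₁ ⊕ E₂ ≃ E`. -/
def familyProdEquiv (f : E₁ ⊕ E₂ ≃ E)
    (hL : ∀ X, X ∈ L ↔ (f ∘ Sum.inl) ⁻¹' X ∈ L₁ ∧ (f ∘ Sum.inr) ⁻¹' X ∈ L₂) : L ≃ L₁ × L₂ where
  toFun X := (⟨_, ((hL X).1 X.2).1⟩, ⟨_, ((hL X).1 X.2).2⟩)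
  invFun Y := ⟨(f ∘ Sum.inl) '' Y.1 ∪ (f ∘ Sum.inr) '' Y.2, by
    rw [hL]
    refine ⟨?_, ?_⟩
    · convert Y.1.2
      ext
      simp
    · convert Y.2.2
      ext
      simp⟩
  left_inv X := by
    ext x
    obtain ⟨y | y, rfl⟩ := f.surjective x <;> simp
  right_inv Y := by ext <;> simp

theorem familyProdEquiv_toggle_inl (f : E₁ ⊕ E₂ ≃ E)
    (hL : ∀ X, X ∈ L ↔ (f ∘ Sum.inl) ⁻¹' X ∈ L₁ ∧ (f ∘ Sum.inr) ⁻¹' X ∈ L₂) (p : E₁) (X : L) :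
    familyProdEquiv f hL (toggle L (f (Sum.inl p)) X) =
      (toggle L₁ p (familyProdEquiv f hL X).1, (familyProdEquiv f hL X).2) := by
  have hinl : (f ∘ Sum.inl) ⁻¹' ((X : Set E) ∆ {f (Sum.inl p)}) = ((f ∘ Sum.inl) ⁻¹' X) ∆ {p} := by
    have hsingleton : (f ∘ Sum.inl) ⁻¹' {f (Sum.inl p)} = {p} := by
      ext
      simp
    rw [Set.preimage_symmDiff, hsingleton]
  have hinr : (f ∘ Sum.inr) ⁻¹' ((X : Set E) ∆ {f (Sum.inl p)}) = (f ∘ Sum.inr) ⁻¹' X := by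
    have hempty : (f ∘ Sum.inr) ⁻¹' {f (Sum.inl p)} = ∅ := by
      ext
      simp
    rw [Set.preimage_symmDiff, hempty, ← Set.bot_eq_empty, symmDiff_bot]
  have hmem : (X : Set E) ∆ {f (Sum.inl p)} ∈ L ↔ ((f ∘ Sum.inl) ⁻¹' X) ∆ {p} ∈ L₁ := by
    rw [hL, hinl, hinr]
    exact and_iff_left ((hL X).1 X.2).2
  refine Prod.ext (Subtype.ext ?_) (Subtype.ext ?_)
  · change (f ∘ Sum.inl) ⁻¹' toggleSet L (f (Sum.inl p)) X = toggleSet L₁ p ((f ∘ Sum.inl) ⁻¹' X)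
    by_cases h : (X : Set E) ∆ {f (Sum.inl p)} ∈ L
    · rw [toggleSet_of_symmDiff_mem h, toggleSet_of_symmDiff_mem (hmem.mp h), hinl]
    · rw [toggleSet_of_symmDiff_notMem h, toggleSet_of_symmDiff_notMem (mt hmem.mpr h)]
  · change (f ∘ Sum.inr) ⁻¹' toggleSet L (f (Sum.inl p)) X = (f ∘ Sum.inr) ⁻¹' X
    by_cases h : (X : Set E) ∆ {f (Sum.inl p)} ∈ L
    · rw [toggleSet_of_symmDiff_mem h, hinr]
    · rw [toggleSet_of_symmDiff_notMem h]

theorem familyProdEquiv_toggle_inr (f : E₁ ⊕ E₂ ≃ E)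
    (hL : ∀ X, X ∈ L ↔ (f ∘ Sum.inl) ⁻¹' X ∈ L₁ ∧ (f ∘ Sum.inr) ⁻¹' X ∈ L₂) (p : E₂) (X : L) :
    familyProdEquiv f hL (toggle L (f (Sum.inr p)) X) =
      ((familyProdEquiv f hL X).1, toggle L₂ p (familyProdEquiv f hL X).2) :=
  congrArg Prod.swap
    (familyProdEquiv_toggle_inl ((sumComm E₂ E₁).trans f) (fun Y => (hL Y).trans and_comm) p X)

theorem exists_toggleGroup_mulEquiv_prod (f : E₁ ⊕ E₂ ≃ E)
    (hL : ∀ X, X ∈ L ↔ (f ∘ Sum.inl) ⁻¹' X ∈ L₁ ∧ (f ∘ Sum.inr) ⁻¹' X ∈ L₂)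
    (h₁ : L₁.Nonempty) (h₂ : L₂.Nonempty) :
    ∃ φ : toggleGroup L ≃* toggleGroup L₁ × toggleGroup L₂,
      (∀ p, φ (toggleGen L (f (Sum.inl p))) = (toggleGen L₁ p, 1)) ∧
      ∀ p, φ (toggleGen L (f (Sum.inr p))) = (1, toggleGen L₂ p) := by
  have := h₁.to_subtype
  have := h₂.to_subtype
  let ε := familyProdEquiv f hL
  let ψ : toggleGroup L₁ × toggleGroup L₂ →* Perm L :=
    ε.symm.permCongrHom.toMonoidHom.comp
      ((permProdHom L₁ L₂).comp ((toggleGroup L₁).subtype.prodMap (toggleGroup L₂).subtype))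
  have hψ : Function.Injective ψ :=
    ε.symm.permCongrHom.injective.comp ((permProdHom_injective L₁ L₂).comp
      (Subtype.val_injective.prodMap Subtype.val_injective))
  let γ : E → toggleGroup L₁ × toggleGroup L₂ :=
    Sum.elim (fun p => (toggleGen L₁ p, 1)) (fun p => (1, toggleGen L₂ p)) ∘ f.symm
  have hγ : Subgroup.closure (Set.range γ) = ⊤ := by
    rw [f.symm.surjective.range_comp]
    exact closure_range_sumElim_eq_top (closure_range_toggleGen L₁) (closure_range_toggleGen L₂)
  have hψγ : ∀ e, ψ (γ e) = toggle L e := by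
    intro e
    obtain ⟨p | p, rfl⟩ := f.surjective e <;> ext1 X <;>
      simp only [γ, Function.comp_apply, f.symm_apply_apply, Sum.elim_inl, Sum.elim_inr]
    · exact ε.symm_apply_eq.mpr (familyProdEquiv_toggle_inl f hL p X).symm
    · exact ε.symm_apply_eq.mpr (familyProdEquiv_toggle_inr f hL p X).symm
  obtain ⟨φ, hφ⟩ := exists_toggleGroup_mulEquiv hψ hγ hψγ
  refine ⟨φ, fun p => ?_, fun p => ?_⟩ <;> simp [hφ, γ]

end Products

section Powersets

open Equiv
open scoped symmDiff

variable {E : Type*}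

theorem closure_range_mulSingle_eq_top {ι : Type*} [Finite ι] [DecidableEq ι] {G : ι → Type*}
    [∀ i, Group (G i)] {γ : ∀ i, G i} (hγ : ∀ i, Subgroup.closure {γ i} = ⊤) :
    Subgroup.closure (Set.range fun i => Pi.mulSingle i (γ i)) = ⊤ := by
  refine eq_top_iff.mpr fun g _ => Subgroup.pi_mem_of_mulSingle_mem g fun i => ?_
  have hle : (⊤ : Subgroup (G i)) ≤ (Subgroup.closure
      (Set.range fun i => Pi.mulSingle i (γ i))).comap (MonoidHom.mulSingle G i) := by
    rw [← hγ i, Subgroup.closure_le, Set.singleton_subset_iff]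
    exact Subgroup.subset_closure (Set.mem_range_self i)
  exact hle trivial

theorem closure_swap_zero_one_eq_top : Subgroup.closure {(swap 0 1 : Perm (Fin 2))} = ⊤ := by
  have honly : ∀ g : Perm (Fin 2), g = 1 ∨ g = swap 0 1 := by decide
  refine eq_top_iff.mpr fun g _ => ?_
  rcases honly g with rfl | rfl
  exacts [one_mem _, Subgroup.mem_closure_singleton_self _]

/-- The identification of the family of all subsets of `E` with the `0`-`1` vectors indexed by `E`,
sending a set to its indicator. -/
noncomputable def indicatorEquiv (E : Type*) : (Set.univ : Set (Set E)) ≃ (E → Fin 2) where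
  toFun X := open Classical in fun e => if e ∈ X.1 then 1 else 0
  invFun v := ⟨{e | v e = 1}, trivial⟩
  left_inv X := by ext; simp
  right_inv v := by
    ext e : 1
    have hv : v e = 0 ∨ v e = 1 := by lia
    rcases hv with h | h <;> simp [h]

theorem indicatorEquiv_toggle [DecidableEq E] (e : E) (X : (Set.univ : Set (Set E))) (i : E) :
    indicatorEquiv E (toggle Set.univ e X) i =
      (Pi.mulSingle e (swap 0 1) : E → Perm (Fin 2)) i (indicatorEquiv E X i) := by
  have hmem : i ∈ (toggle Set.univ e X).1 ↔ i ∈ X.1 ∆ {e} := by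
    change i ∈ toggleSet Set.univ e X.1 ↔ _
    rw [toggleSet_of_symmDiff_mem (Set.mem_univ _)]
  rcases eq_or_ne i e with rfl | hi <;> by_cases hX : i ∈ X.1 <;>
    simp [indicatorEquiv, Set.mem_symmDiff, *]

theorem nonempty_toggleGroup_univ_mulEquiv_pi [Finite E] :
    Nonempty (toggleGroup (Set.univ : Set (Set E)) ≃* (E → Perm (Fin 2))) := by
  classical
  let π : (E → Perm (Fin 2)) →* Perm (E → Fin 2) :=
    { toFun := piCongrRight, map_one' := rfl, map_mul' _ _ := rfl }
  have hπ : Function.Injective π := fun g h hgh =>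
    funext fun e => Equiv.ext fun t => congrFun (DFunLike.congr_fun hgh fun _ => t) e
  let ψ := (indicatorEquiv E).symm.permCongrHom.toMonoidHom.comp π
  have hψ : Function.Injective ψ := (indicatorEquiv E).symm.permCongrHom.injective.comp hπ
  have hψγ : ∀ e, ψ (Pi.mulSingle e (swap 0 1)) = toggle Set.univ e := fun e => by
    ext1 X
    exact (symm_apply_eq _).mpr (funext fun i => (indicatorEquiv_toggle e X i).symm)
  exact (exists_toggleGroup_mulEquiv hψ
    (closure_range_mulSingle_eq_top fun _ => closure_swap_zero_one_eq_top) hψγ).nonempty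

end Powersets

section Extension

open MulAction
open scoped symmDiff

variable {E : Type*} {L : Set (Set E)}

theorem toggleAlternating_iff [Finite E] [Fintype L] [DecidableEq L] :
    ToggleAlternating L ↔ alternatingGroup L ≤ toggleGroup L := by
  unfold ToggleAlternating
  convert Iff.rfl

theorem isPretransitive_toggleGroup [Finite E] (hempty : ∅ ∈ L)
    (hL : ∀ X ∈ L, X.Nonempty → ∃ e ∈ X, X \ {e} ∈ L) : IsPretransitive (toggleGroup L) L := by
  rw [isPretransitive_iff_base (⟨∅, hempty⟩ : L)]
  rintro ⟨X, hX⟩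
  induction X using WellFoundedLT.induction with
  | ind X ih =>
    obtain rfl | hne := X.eq_empty_or_nonempty
    · exact ⟨1, one_smul _ _⟩
    · obtain ⟨e, he, hXe⟩ := hL X hX hne
      obtain ⟨g, hg⟩ := ih _ (Set.sdiff_singleton_ssubset.mpr he) hXe
      have hremove : toggle L e ⟨X, hX⟩ = ⟨X \ {e}, hXe⟩ := Subtype.ext <| by
        have hmem : X ∆ {e} ∈ L := (symmDiff_singleton_of_mem he).symm ▸ hXe
        exact (toggleSet_of_symmDiff_mem hmem).trans (symmDiff_singleton_of_mem he)
      refine ⟨(toggleGen L e)⁻¹ * g, ?_⟩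
      rw [mul_smul, hg, inv_smul_eq_iff]
      exact hremove.symm

theorem exists_mem_toggleGroup_extending (e : E) {g : Equiv.Perm {X ∈ L | e ∉ X}}
    (hg : g ∈ toggleGroup {X ∈ L | e ∉ X}) :
    ∃ h ∈ toggleGroup L, ∀ X, h (Set.inclusion (Set.sep_subset L (e ∉ ·)) X) =
      Set.inclusion (Set.sep_subset L (e ∉ ·)) (g X) := by
  induction hg using Subgroup.closure_induction with
  | one => exact ⟨1, one_mem _, fun _ => rfl⟩
  | mul g g' _ _ ih ih' =>
    obtain ⟨h, hh, hgh⟩ := ih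
    obtain ⟨h', hh', hgh'⟩ := ih'
    exact ⟨h * h', mul_mem hh hh', fun X => by
      rw [Equiv.Perm.mul_apply, hgh', hgh, Equiv.Perm.mul_apply]⟩
  | inv g _ ih =>
    obtain ⟨h, hh, hgh⟩ := ih
    refine ⟨h⁻¹, inv_mem hh, fun X => ?_⟩
    rw [Equiv.Perm.inv_eq_iff_eq, hgh, ← Equiv.Perm.mul_apply, mul_inv_cancel,
      Equiv.Perm.one_apply]
  | mem g hg =>
    obtain ⟨q, rfl⟩ := hg
    rcases eq_or_ne q e with rfl | hqe
    · refine ⟨1, one_mem _, fun X => Subtype.ext ?_⟩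
      have hnot : (X : Set E) ∆ {q} ∉ {Y ∈ L | q ∉ Y} := fun h =>
        h.2 (by simp [Set.mem_symmDiff, X.2.2])
      exact (toggleSet_of_symmDiff_notMem hnot).symm
    · refine ⟨toggle L q, toggle_mem_toggleGroup L q, fun X => Subtype.ext ?_⟩
      have hiff : (X : Set E) ∆ {q} ∈ {Y ∈ L | e ∉ Y} ↔ (X : Set E) ∆ {q} ∈ L :=
        and_iff_left (by simp [Set.mem_symmDiff, X.2.2, hqe.symm])
      change toggleSet L q X = toggleSet _ q X
      by_cases hX : (X : Set E) ∆ {q} ∈ L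
      · rw [toggleSet_of_symmDiff_mem hX, toggleSet_of_symmDiff_mem (hiff.mpr hX)]
      · rw [toggleSet_of_symmDiff_notMem hX, toggleSet_of_symmDiff_notMem (mt hiff.mp hX)]

theorem ncard_lt_two_mul_ncard_sep_notMem [Finite E] {e : E}
    (hL : ∀ X ∈ L, e ∈ X → X \ {e} ∈ L) {W : Set E} (hW : W ∈ L) (heW : e ∉ W)
    (hinsert : insert e W ∉ L) :
    L.ncard < 2 * {X ∈ L | e ∉ X}.ncard := by
  have hinj : Set.InjOn (· \ {e}) {X ∈ L | e ∈ X} := fun X hX Y hY h => by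
    rw [← Set.insert_sdiff_self_of_mem hX.2, ← Set.insert_sdiff_self_of_mem hY.2]
    exact congrArg (insert e) h
  have hssubset : (· \ {e}) '' {X ∈ L | e ∈ X} ⊂ {X ∈ L | e ∉ X} := by
    refine (Set.ssubset_iff_of_subset ?_).mpr ⟨W, ⟨hW, heW⟩, ?_⟩
    · rintro _ ⟨X, ⟨hX, heX⟩, rfl⟩
      exact ⟨hL X hX heX, fun h => h.2 rfl⟩
    · rintro ⟨X, ⟨hX, heX⟩, rfl⟩
      exact hinsert (by rwa [Set.insert_sdiff_self_of_mem heX])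
  have hlt := Set.ncard_lt_ncard hssubset
  have hadd := Set.ncard_inter_add_ncard_sdiff_eq_ncard L {X | e ∈ X}
  rw [hinj.ncard_image] at hlt
  change {X ∈ L | e ∈ X}.ncard + {X ∈ L | e ∉ X}.ncard = _ at hadd
  lia

theorem toggleAlternating_of_sep_notMem [Finite E] [IsPretransitive (toggleGroup L) L] (e : E)
    (h5 : 5 ≤ {X ∈ L | e ∉ X}.ncard) (hcard : L.ncard < 2 * {X ∈ L | e ∉ X}.ncard)
    (halt : ToggleAlternating {X ∈ L | e ∉ X}) : ToggleAlternating L := by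
  classical
  have := Fintype.ofFinite L
  have := Fintype.ofFinite {X ∈ L | e ∉ X}
  rw [toggleAlternating_iff] at halt ⊢
  let κ : {X : L // e ∉ X.1} ≃ {X ∈ L | e ∉ X} :=
    Equiv.subtypeSubtypeEquivSubtypeInter (· ∈ L) (e ∉ ·)
  rw [← Nat.card_coe_set_eq {X ∈ L | e ∉ X}, ← Nat.card_congr κ] at h5 hcard
  rw [← Nat.card_coe_set_eq] at hcard
  refine alternatingGroup_le_of_map_ofSubtype_le (p := fun X : L => e ∉ X.1) (by lia) hcard
    (map_ofSubtype_alternatingGroup_le h5 hcard fun g hg => ?_)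
  have hκg : κ.permCongr g ∈ alternatingGroup {X ∈ L | e ∉ X} := by
    rwa [Equiv.Perm.mem_alternatingGroup, Equiv.Perm.sign_permCongr]
  obtain ⟨h, hh, hgh⟩ := exists_mem_toggleGroup_extending e (halt hκg)
  refine ⟨h, hh, fun X => ?_⟩
  have hX := hgh (κ X)
  rwa [Equiv.permCongr_apply, κ.symm_apply_apply] at hX

end Extension

section RelativeIntervalClosed

variable {P : Type*} [PartialOrder P]

/-- The family `𝓘𝓒(R)` of interval-closed sets of a subposet `R` of `P`. Its members are encoded as
subsets of `P`, so that the families of nested subposets can be compared inside `Set P`. -/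
def intervalClosedIn (R : Set P) : Set (Set P) :=
  {I | I ⊆ R ∧ ∀ x ∈ I, ∀ y ∈ I, ∀ z ∈ R, x < z → z < y → z ∈ I}

theorem mem_intervalClosedSets_iff_forall_lt_lt {I : Set P} :
    I ∈ intervalClosedSets P ↔ ∀ x ∈ I, ∀ y ∈ I, ∀ z, x < z → z < y → z ∈ I := by
  refine ⟨fun h x hx y hy z hxz hzy => Set.OrdConnected.out h hx hy ⟨hxz.le, hzy.le⟩,
    fun h => ⟨fun x hx y hy z hz => ?_⟩⟩
  rcases hz.1.eq_or_lt with rfl | hxz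
  · exact hx
  rcases hz.2.eq_or_lt with rfl | hzy
  · exact hy
  exact h x hx y hy z hxz hzy

theorem intervalClosedIn_univ : intervalClosedIn (Set.univ : Set P) = intervalClosedSets P := by
  ext I
  simp [intervalClosedIn, mem_intervalClosedSets_iff_forall_lt_lt]

theorem empty_mem_intervalClosedIn (R : Set P) : ∅ ∈ intervalClosedIn R :=
  ⟨Set.empty_subset R, by simp⟩

theorem singleton_mem_intervalClosedIn {R : Set P} {x : P} (hx : x ∈ R) :
    {x} ∈ intervalClosedIn R := by
  refine ⟨Set.singleton_subset_iff.mpr hx, ?_⟩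
  rintro _ rfl _ rfl z _ hxz hzx
  exact absurd hzx hxz.asymm

theorem sdiff_singleton_mem_intervalClosedIn {R I : Set P} (hI : I ∈ intervalClosedIn R) {p : P}
    (hp : Maximal (· ∈ I) p ∨ Minimal (· ∈ I) p) : I \ {p} ∈ intervalClosedIn R := by
  refine ⟨Set.sdiff_subset.trans hI.1, fun x hx y hy z hz hxz hzy =>
    ⟨hI.2 x hx.1 y hy.1 z hz hxz hzy, ?_⟩⟩
  rintro rfl
  exact hp.elim (fun hmax => hmax.not_gt hy.1 hzy) fun hmin => hmin.not_lt hx.1 hxz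

theorem isPretransitive_intervalClosedIn [Finite P] (R : Set P) :
    MulAction.IsPretransitive (toggleGroup (intervalClosedIn R)) (intervalClosedIn R) := by
  refine isPretransitive_toggleGroup (empty_mem_intervalClosedIn R) fun I hI hne => ?_
  obtain ⟨m, hm⟩ := I.toFinite.exists_maximal hne
  exact ⟨m, hm.prop, sdiff_singleton_mem_intervalClosedIn hI (Or.inl hm)⟩

theorem sep_notMem_intervalClosedIn {R : Set P} {p : P}
    (hp : Maximal (· ∈ R) p ∨ Minimal (· ∈ R) p) :
    {I ∈ intervalClosedIn R | p ∉ I} = intervalClosedIn (R \ {p}) := by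
  ext I
  constructor
  · rintro ⟨hI, hpI⟩
    exact ⟨Set.subset_sdiff_singleton hI.1 hpI, fun x hx y hy z hz => hI.2 x hx y hy z hz.1⟩
  · intro hI
    refine ⟨⟨hI.1.trans Set.sdiff_subset, fun x hx y hy z hz hxz hzy =>
      hI.2 x hx y hy z ⟨hz, ?_⟩ hxz hzy⟩, fun hpI => (hI.1 hpI).2 rfl⟩
    rintro rfl
    exact hp.elim (fun hmax => hmax.not_gt (hI.1 hy).1 hzy)
      fun hmin => hmin.not_lt (hI.1 hx).1 hxz

theorem ncard_add_two_le_ncard_intervalClosedIn [Finite P] {R : Set P} (hR : 1 < R.ncard) :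
    R.ncard + 2 ≤ (intervalClosedIn R).ncard := by
  have hsubset : insert ∅ (insert R (singleton '' R)) ⊆ intervalClosedIn R := by
    rintro _ (rfl | rfl | ⟨x, hx, rfl⟩)
    · exact empty_mem_intervalClosedIn R
    · exact ⟨subset_rfl, fun _ _ _ _ z hz _ _ => hz⟩
    · exact singleton_mem_intervalClosedIn hx
  have hfull : R ∉ singleton '' R := by
    rintro ⟨x, -, h⟩
    rw [← h, Set.ncard_singleton] at hR
    exact hR.ne rfl
  have hempty : ∅ ∉ insert R (singleton '' R) := by
    rintro (h | ⟨x, -, h⟩)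
    · simp [← h] at hR
    · exact Set.singleton_ne_empty x h
  have hle := Set.ncard_le_ncard hsubset
  rwa [Set.ncard_insert_of_notMem hempty, Set.ncard_insert_of_notMem hfull,
    Set.ncard_image_of_injective R Set.singleton_injective] at hle

theorem toggleAlternating_intervalClosedIn_of_sdiff [Finite P] {R : Set P} {p : P}
    (hp : Maximal (· ∈ R) p ∨ Minimal (· ∈ R) p)
    (hchain : ∃ x ∈ R, ∃ z ∈ R, x < z ∧ z < p ∨ p < z ∧ z < x) (h3 : 3 ≤ (R \ {p}).ncard)
    (halt : ToggleAlternating (intervalClosedIn (R \ {p}))) :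
    ToggleAlternating (intervalClosedIn R) := by
  have := isPretransitive_intervalClosedIn R
  obtain ⟨x, hx, z, hz, hxzp⟩ := hchain
  have hremove : ∀ I ∈ intervalClosedIn R, p ∈ I → I \ {p} ∈ intervalClosedIn R :=
    fun I hI hpI => sdiff_singleton_mem_intervalClosedIn hI
      (hp.imp (·.mono hI.1 hpI) (·.mono hI.1 hpI))
  have hne : p ≠ x ∧ z ≠ x ∧ z ≠ p := by grind
  have hinsert : insert p {x} ∉ intervalClosedIn R := by
    intro h
    have hzmem : z ∈ ({p, x} : Set P) := by
      rcases hxzp with ⟨hxz, hzp⟩ | ⟨hpz, hzx⟩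
      · exact h.2 x (by simp) p (by simp) z hz hxz hzp
      · exact h.2 p (by simp) x (by simp) z hz hpz hzx
    exact hzmem.elim hne.2.2 hne.2.1
  have hcard := ncard_lt_two_mul_ncard_sep_notMem hremove (singleton_mem_intervalClosedIn hx)
    hne.1 hinsert
  have h5 := ncard_add_two_le_ncard_intervalClosedIn (R := R \ {p}) (by lia)
  rw [← sep_notMem_intervalClosedIn hp] at halt h5
  exact toggleAlternating_of_sep_notMem p (by lia) hcard halt

end RelativeIntervalClosed

section Chains

open Equiv
open scoped commutatorElement symmDiff

variable {P : Type*} [PartialOrder P]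

theorem mem_intervalClosedIn_triple {a b c : P} (hab : a < b) (hbc : b < c) {I : Set P} :
    I ∈ intervalClosedIn {a, b, c} ↔ I ⊆ {a, b, c} ∧ (a ∈ I → c ∈ I → b ∈ I) := by
  refine and_congr_right fun hI => ⟨fun h ha hc => h a ha c hc b (by simp) hab hbc, ?_⟩
  intro h x hx y hy z hz hxz hzy
  have heq : x = a ∧ z = b ∧ y = c := by
    rcases hI hx with rfl | rfl | rfl <;> rcases hz with rfl | rfl | rfl <;>
      rcases hI hy with rfl | rfl | rfl <;> first | exact ⟨rfl, rfl, rfl⟩ | (exfalso; order)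
  obtain ⟨rfl, rfl, rfl⟩ := heq
  exact h hx hy

theorem intervalClosedIn_triple {a b c : P} (hab : a < b) (hbc : b < c) :
    intervalClosedIn {a, b, c} = 𝒫 {a, b, c} \ {{a, c}} := by
  ext I
  rw [mem_intervalClosedIn_triple hab hbc]
  refine and_congr_right fun hI => ⟨?_, fun hne ha hc => ?_⟩
  · rintro h rfl
    simpa [hab.ne', hbc.ne] using h (by simp) (by simp)
  · by_contra hb
    refine hne (Set.Subset.antisymm (fun x hx => ?_) (by simp [Set.insert_subset_iff, ha, hc]))
    rcases hI hx with rfl | rfl | rfl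
    exacts [by simp, absurd hx hb, by simp]

theorem ncard_intervalClosedIn_triple {a b c : P} (hab : a < b) (hbc : b < c) :
    (intervalClosedIn {a, b, c}).ncard = 7 := by
  have hcard : ({a, b, c} : Set P).ncard = 3 :=
    Set.ncard_eq_three.mpr ⟨a, b, c, hab.ne, (hab.trans hbc).ne, hbc.ne, rfl⟩
  have hac : {a, c} ∈ 𝒫 ({a, b, c} : Set P) := by simp [Set.insert_subset_iff]
  rw [intervalClosedIn_triple hab hbc, Set.ncard_sdiff_singleton_of_mem hac,
    Set.ncard_powerset _ (Set.toFinite _), hcard]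
  norm_num

theorem pair_notMem_intervalClosedIn_triple {a b c : P} (hab : a < b) (hbc : b < c) :
    {a, c} ∉ intervalClosedIn {a, b, c} := by
  simp [intervalClosedIn_triple hab hbc]

theorem toggle_comm_of_mem_intervalClosedIn_triple {a b c : P} (hab : a < b) (hbc : b < c)
    (I : intervalClosedIn {a, b, c}) (hI : b ∈ I.1) :
    toggle (intervalClosedIn {a, b, c}) a (toggle (intervalClosedIn {a, b, c}) c I) =
      toggle (intervalClosedIn {a, b, c}) c (toggle (intervalClosedIn {a, b, c}) a I) := by
  have hmem {J : Set P} (hJ : J ⊆ {a, b, c}) (hb : b ∈ J) : J ∈ intervalClosedIn {a, b, c} :=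
    (mem_intervalClosedIn_triple hab hbc).mpr ⟨hJ, fun _ _ => hb⟩
  have hstep {J : Set P} {e : P} (he : e ∈ ({a, b, c} : Set P)) (hbe : b ≠ e)
      (hJ : J ⊆ {a, b, c}) (hb : b ∈ J) : J ∆ {e} ⊆ {a, b, c} ∧ b ∈ J ∆ {e} :=
    ⟨Set.symmDiff_subset_union.trans (Set.union_subset hJ (Set.singleton_subset_iff.mpr he)),
      Or.inl ⟨hb, hbe⟩⟩
  obtain ⟨ha, hba⟩ := hstep (by simp) hab.ne' I.2.1 hI
  obtain ⟨hc, hbc'⟩ := hstep (e := c) (by simp) hbc.ne I.2.1 hI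
  obtain ⟨hac, hbac⟩ := hstep (e := c) (by simp) hbc.ne ha hba
  exact toggle_toggle_comm (hmem ha hba) (hmem hc hbc') (hmem hac hbac)

theorem isThreeCycle_commutator_toggle {a b c : P} (hab : a < b) (hbc : b < c)
    [Fintype (intervalClosedIn {a, b, c})] [DecidableEq (intervalClosedIn {a, b, c})] :
    Perm.IsThreeCycle
      ⁅toggle (intervalClosedIn {a, b, c}) a, toggle (intervalClosedIn {a, b, c}) c⁆ := by
  have hac : a ≠ c := (hab.trans hbc).ne
  have ha : {a} ∈ intervalClosedIn {a, b, c} := singleton_mem_intervalClosedIn (by simp)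
  have hc : {c} ∈ intervalClosedIn {a, b, c} := singleton_mem_intervalClosedIn (by simp)
  have hpair := pair_notMem_intervalClosedIn_triple hab hbc
  have hfix_c : ({c} : Set P) ∆ {a} ∉ intervalClosedIn {a, b, c} := by
    rwa [symmDiff_singleton_of_notMem (by simpa using hac), Set.union_singleton]
  have hfix_a : ({a} : Set P) ∆ {c} ∉ intervalClosedIn {a, b, c} := by rwa [symmDiff_comm]
  have hadd {e : P} (he : {e} ∈ intervalClosedIn {a, b, c}) :
      toggle (intervalClosedIn {a, b, c}) e ⟨∅, empty_mem_intervalClosedIn _⟩ = ⟨{e}, he⟩ := by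
    have hsymmDiff : (∅ : Set P) ∆ {e} = {e} := bot_symmDiff _
    exact Subtype.ext
      ((toggleSet_of_symmDiff_mem (hsymmDiff.symm ▸ he)).trans hsymmDiff)
  have hremove {e : P} (he : {e} ∈ intervalClosedIn {a, b, c}) :
      toggle (intervalClosedIn {a, b, c}) e ⟨{e}, he⟩ = ⟨∅, empty_mem_intervalClosedIn _⟩ := by
    rw [← hadd he]
    exact (toggle _ e).left_inv _
  refine isThreeCycle_commutator (x := ⟨∅, empty_mem_intervalClosedIn _⟩) (y := ⟨{a}, ha⟩)
    (z := ⟨{c}, hc⟩) (by simp)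
    (by simp) (by simpa using hac) (hadd ha) (hremove ha)
    (Subtype.ext (toggleSet_of_symmDiff_notMem hfix_c)) (hadd hc)
    (Subtype.ext (toggleSet_of_symmDiff_notMem hfix_a)) (hremove hc) fun I h0 h1 h2 => ?_
  refine toggle_comm_of_mem_intervalClosedIn_triple hab hbc I ?_
  by_contra hb
  have hsub : I.1 ⊆ {a, c} := fun x hx => (I.2.1 hx).imp_right
    (·.resolve_left (by rintro rfl; exact hb hx))
  rcases Set.subset_pair_iff_eq.mp hsub with h | h | h | h
  exacts [h0 (Subtype.ext h), h1 (Subtype.ext h), h2 (Subtype.ext h), hpair (h ▸ I.2)]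

theorem toggleAlternating_intervalClosedIn_triple [Finite P] {a b c : P} (hab : a < b)
    (hbc : b < c) : ToggleAlternating (intervalClosedIn {a, b, c}) := by
  classical
  have := Fintype.ofFinite (intervalClosedIn {a, b, c})
  have := isPretransitive_intervalClosedIn {a, b, c}
  have hprim : MulAction.IsPreprimitive (toggleGroup (intervalClosedIn {a, b, c}))
      (intervalClosedIn {a, b, c}) := by
    refine MulAction.IsPreprimitive.of_prime_card ?_
    rw [Nat.card_coe_set_eq, ncard_intervalClosedIn_triple hab hbc]
    norm_num
  rw [toggleAlternating_iff]
  exact Perm.alternatingGroup_le_of_isPreprimitive_of_isThreeCycle_mem hprim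
    (isThreeCycle_commutator_toggle hab hbc)
    ⁅toggleGen (intervalClosedIn {a, b, c}) a, toggleGen (intervalClosedIn {a, b, c}) c⁆.2

theorem exists_isGreatest_of_isChain {R : Set P} (hR : IsChain (· ≤ ·) R) (hfin : R.Finite)
    (hne : R.Nonempty) : ∃ c, IsGreatest R c := by
  obtain ⟨c, hc⟩ := hfin.exists_maximal hne
  exact ⟨c, hc.prop, fun x hx => (hR.total hx hc.prop).elim id (hc.le_of_ge hx)⟩

theorem exists_lt_lt_isGreatest_of_isChain {R : Set P} (hR : IsChain (· ≤ ·) R)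
    (h3 : 3 ≤ R.ncard) : ∃ a ∈ R, ∃ b ∈ R, ∃ c, IsGreatest R c ∧ a < b ∧ b < c := by
  have hfin : R.Finite := Set.finite_of_ncard_pos (by lia)
  obtain ⟨c, hc⟩ := exists_isGreatest_of_isChain hR hfin (Set.nonempty_of_ncard_ne_zero (by lia))
  have hcardc := Set.ncard_sdiff_singleton_add_one hc.1 hfin
  obtain ⟨b, hb⟩ := exists_isGreatest_of_isChain (hR.mono Set.sdiff_subset) hfin.sdiff
    (Set.nonempty_of_ncard_ne_zero (s := R \ {c}) (by lia))
  have hcardb := Set.ncard_sdiff_singleton_add_one hb.1 hfin.sdiff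
  obtain ⟨a, ha⟩ := Set.nonempty_of_ncard_ne_zero (s := (R \ {c}) \ {b}) (by lia)
  exact ⟨a, ha.1.1, b, hb.1.1, c, hc, (hb.2 ha.1).lt_of_ne ha.2, (hc.2 hb.1.1).lt_of_ne hb.1.2⟩

theorem toggleAlternating_intervalClosedIn_of_isChain [Finite P] {R : Set P}
    (hR : IsChain (· ≤ ·) R) (h3 : 3 ≤ R.ncard) : ToggleAlternating (intervalClosedIn R) := by
  induction R using WellFoundedLT.induction with
  | ind R ih =>
    obtain ⟨a, ha, b, hb, c, hc, hab, hbc⟩ := exists_lt_lt_isGreatest_of_isChain hR h3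
    obtain h3' | h3' := h3.eq_or_lt
    · have hcard : ({a, b, c} : Set P).ncard = 3 :=
        Set.ncard_eq_three.mpr ⟨a, b, c, hab.ne, (hab.trans hbc).ne, hbc.ne, rfl⟩
      have htriple : {a, b, c} = R := Set.eq_of_subset_of_ncard_le
        (by simp [Set.insert_subset_iff, ha, hb, hc.1]) (by lia)
      exact htriple ▸ toggleAlternating_intervalClosedIn_triple hab hbc
    · have hcardc := Set.ncard_sdiff_singleton_add_one hc.1
      refine toggleAlternating_intervalClosedIn_of_sdiff (Or.inl ⟨hc.1, fun x hx _ => hc.2 hx⟩)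
        ⟨a, ha, b, hb, Or.inl ⟨hab, hbc⟩⟩ (by lia) ?_
      exact ih _ (Set.sdiff_singleton_ssubset.mpr hc.1) (hR.mono Set.sdiff_subset) (by lia)

end Chains

section ExtremalAtomic

variable {P : Type*} [PartialOrder P]

theorem intervalClosedSets_nonempty : (intervalClosedSets P).Nonempty :=
  ⟨∅, Set.ordConnected_empty⟩

theorem intervalClosedSets_eq_univ_of_forall_lt_not_lt (hP : ∀ x y z : P, x < z → ¬ z < y) :
    intervalClosedSets P = Set.univ :=
  Set.eq_univ_of_forall fun _ => mem_intervalClosedSets_iff_forall_lt_lt.mpr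
    fun x _ y _ z hxz hzy => absurd hzy (hP x y z hxz)

theorem intervalClosedSets_eq_univ_of_subsingleton [Subsingleton P] :
    intervalClosedSets P = Set.univ :=
  intervalClosedSets_eq_univ_of_forall_lt_not_lt fun x _ z hxz =>
    absurd (Subsingleton.elim x z) hxz.ne

theorem HasOnlyTwoRanks.intervalClosedSets_eq_univ [Finite P] (hP : HasOnlyTwoRanks P) :
    intervalClosedSets P = Set.univ := by
  classical
  have := Fintype.ofFinite P
  let := Fintype.toLocallyFiniteOrder (α := P)
  obtain ⟨ρ, hρ, hcard⟩ := hP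
  have hmono : StrictMono ρ := (strictMono_iff_forall_covBy ρ).mpr fun x y hxy => by
    rw [hρ x y hxy]
    exact lt_add_one _
  refine intervalClosedSets_eq_univ_of_forall_lt_not_lt fun x y z hxz hzy => ?_
  have hthree : ({ρ x, ρ z, ρ y} : Set ℤ).encard = 3 := Set.encard_eq_three.mpr
    ⟨ρ x, ρ z, ρ y, (hmono hxz).ne, (hmono (hxz.trans hzy)).ne, (hmono hzy).ne, rfl⟩
  have hsubset : ({ρ x, ρ z, ρ y} : Set ℤ) ⊆ Set.range ρ := by simp [Set.insert_subset_iff]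
  have hle := (Set.encard_le_encard hsubset).trans hcard
  rw [hthree] at hle
  exact absurd hle (by decide)

theorem IsExtremalAtomic.ne_of_lt_of_lt [Finite P] {m x y z : P} (hm : IsExtremalAtomic m)
    (hxz : x < z) (hzy : z < y) : x ≠ m ∧ z ≠ m ∧ y ≠ m := by
  rcases hm with ⟨hmax, hcov⟩ | ⟨hmin, hcov⟩
  · refine ⟨?_, ?_, ?_⟩ <;> rintro rfl
    · exact hmax.not_lt hxz
    · exact hmax.not_lt hzy
    · obtain ⟨t, hzt, hty⟩ := exists_le_covBy_of_lt hzy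
      exact (hcov t hty).not_lt (hxz.trans_le hzt)
  · refine ⟨?_, ?_, ?_⟩ <;> rintro rfl
    · obtain ⟨t, hxt, htz⟩ := exists_covBy_le_of_lt hxz
      exact (hcov t hxt).not_lt (htz.trans_lt hzy)
    · exact hmin.not_lt hxz
    · exact hmin.not_lt hzy

theorem exists_lt_lt_of_not_isExtremalAtomic {m : P} (hm : IsMax m ∨ IsMin m)
    (hna : ¬ IsExtremalAtomic m) : ∃ x z, x < z ∧ z < m ∨ m < z ∧ z < x := by
  rw [IsExtremalAtomic] at hna
  push Not at hna
  rcases hm with hmax | hmin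
  · obtain ⟨z, hzm, hz⟩ := hna.1 hmax
    obtain ⟨x, hxz⟩ := not_isMin_iff.mp hz
    exact ⟨x, z, Or.inl ⟨hxz, hzm.lt⟩⟩
  · obtain ⟨z, hmz, hz⟩ := hna.2 hmin
    obtain ⟨x, hzx⟩ := not_isMax_iff.mp hz
    exact ⟨x, z, Or.inr ⟨hmz.lt, hzx⟩⟩

theorem IsExtremalAtomic.mem_intervalClosedSets_iff [Finite P] {m : P} (hm : IsExtremalAtomic m)
    (I : Set P) : I ∈ intervalClosedSets P ↔
      ((↑) ⁻¹' I : Set ({m}ᶜ : Set P)) ∈ intervalClosedSets ({m}ᶜ : Set P) ∧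
        ((↑) ⁻¹' I : Set ({m} : Set P)) ∈ intervalClosedSets ({m} : Set P) := by
  rw [intervalClosedSets_eq_univ_of_subsingleton (P := ({m} : Set P)),
    and_iff_left (Set.mem_univ _)]
  refine ⟨fun hI => ⟨fun x hx y hy z hz => Set.OrdConnected.out hI hx hy hz⟩, fun hI => ?_⟩
  rw [mem_intervalClosedSets_iff_forall_lt_lt] at hI ⊢
  intro x hx y hy z hxz hzy
  obtain ⟨hxm, hzm, hym⟩ := hm.ne_of_lt_of_lt hxz hzy
  exact hI ⟨x, hxm⟩ hx ⟨y, hym⟩ hy ⟨z, hzm⟩ hxz hzy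

theorem mem_intervalClosedSets_iff_of_orderIso {P₁ P₂ : Type*} [PartialOrder P₁] [PartialOrder P₂]
    (f : P₁ ⊕ P₂ ≃o P) (I : Set P) : I ∈ intervalClosedSets P ↔
      (f ∘ Sum.inl) ⁻¹' I ∈ intervalClosedSets P₁ ∧
        (f ∘ Sum.inr) ⁻¹' I ∈ intervalClosedSets P₂ := by
  refine ⟨fun h => ⟨Set.OrdConnected.preimage_mono h (f.monotone.comp Sum.inl_mono),
    Set.OrdConnected.preimage_mono h (f.monotone.comp Sum.inr_mono)⟩,
    fun h => ⟨fun x hx y hy z hz => ?_⟩⟩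
  obtain ⟨x, rfl⟩ := f.surjective x
  obtain ⟨y, rfl⟩ := f.surjective y
  obtain ⟨z, rfl⟩ := f.surjective z
  rw [Set.mem_Icc, f.le_iff_le, f.le_iff_le] at hz
  rcases x with x | x <;> rcases y with y | y <;> rcases z with z | z <;>
    simp only [Sum.inl_le_inl_iff, Sum.inr_le_inr_iff, Sum.not_inl_le_inr, Sum.not_inr_le_inl,
      and_false, false_and] at hz
  exacts [Set.OrdConnected.out h.1 hx hy hz, Set.OrdConnected.out h.2 hx hy hz]

end ExtremalAtomic

section StronglyExtremalAtomicFree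

theorem antitone_remainingSubposet {P : Type*} (p : ℕ → P) : Antitone (remainingSubposet p) :=
  antitone_nat_of_succ_le fun _ => Set.sdiff_subset

variable {P : Type*} [PartialOrder P]

theorem toggleAlternating_intervalClosedIn_of_not_isExtremalAtomic [Finite P] {R : Set P} {p : P}
    (hp : Maximal (· ∈ R) p ∨ Minimal (· ∈ R) p) (hna : ∀ m : R, ¬ IsExtremalAtomic m)
    (h3 : 3 ≤ (R \ {p}).ncard) (halt : ToggleAlternating (intervalClosedIn (R \ {p}))) :
    ToggleAlternating (intervalClosedIn R) := by
  have hpR : p ∈ R := hp.elim (·.prop) (·.prop)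
  have hextremal : IsMax (⟨p, hpR⟩ : R) ∨ IsMin (⟨p, hpR⟩ : R) :=
    hp.imp (fun h x hx => h.le_of_ge x.2 hx) fun h x hx => h.le_of_le x.2 hx
  obtain ⟨x, z, hxz⟩ := exists_lt_lt_of_not_isExtremalAtomic hextremal (hna _)
  exact toggleAlternating_intervalClosedIn_of_sdiff hp ⟨x, x.2, z, z.2, hxz⟩ h3 halt

theorem toggleAlternating_of_isStronglyExtremalAtomicFree [Finite P]
    (hP : IsStronglyExtremalAtomicFree P) : ToggleAlternating (intervalClosedSets P) := by
  obtain ⟨n, p, hchain, hcard, hextremal, hfree⟩ := hP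
  have h3 : 3 ≤ (remainingSubposet p n).ncard := by
    rw [← (Set.toFinite _).cast_ncard_eq] at hcard
    exact_mod_cast hcard
  rw [← intervalClosedIn_univ]
  refine Nat.decreasingInduction' (m := 0)
    (P := fun i => ToggleAlternating (intervalClosedIn (remainingSubposet p i)))
    (fun i hi _ halt => ?_) (Nat.zero_le n)
    (toggleAlternating_intervalClosedIn_of_isChain hchain h3)
  exact toggleAlternating_intervalClosedIn_of_not_isExtremalAtomic (hextremal i hi)
    (hfree i hi.le).2 (h3.trans (Set.ncard_le_ncard (antitone_remainingSubposet p hi))) halt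

end StronglyExtremalAtomicFree

theorem mainTheorem6 (P : Type u) [PartialOrder P] [Finite P] :
    -- disjoint unions: the isomorphism matches each toggle with the corresponding toggle
    (∀ (P₁ : Type v) (P₂ : Type w) [PartialOrder P₁] [PartialOrder P₂] (f : P₁ ⊕ P₂ ≃o P),
      ∃ φ : toggleGroup (intervalClosedSets P) ≃*
          toggleGroup (intervalClosedSets P₁) × toggleGroup (intervalClosedSets P₂),
        (∀ p : P₁, φ (toggleGen _ (f (Sum.inl p))) = (toggleGen _ p, 1)) ∧
        (∀ p : P₂, φ (toggleGen _ (f (Sum.inr p))) = (1, toggleGen _ p))) ∧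
    -- extremal-atomic elements
    (∀ m : P, IsExtremalAtomic m →
      (∃ φ : toggleGroup (intervalClosedSets P) ≃*
          toggleGroup (intervalClosedSets ({m}ᶜ : Set P)) ×
            toggleGroup (intervalClosedSets ({m} : Set P)),
        (∀ p : ({m}ᶜ : Set P), φ (toggleGen _ (p : P)) = (toggleGen _ p, 1)) ∧
        (∀ p : ({m} : Set P), φ (toggleGen _ (p : P)) = (1, toggleGen _ p))) ∧
      Nonempty (toggleGroup (intervalClosedSets P) ≃*
        toggleGroup (intervalClosedSets ({m}ᶜ : Set P)) × Equiv.Perm (Fin 2))) ∧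
    -- posets with only two ranks
    (HasOnlyTwoRanks P →
      Nonempty (toggleGroup (intervalClosedSets P) ≃* (P → Equiv.Perm (Fin 2)))) ∧
    -- strongly-extremal-atomic-free posets
    (IsStronglyExtremalAtomicFree P → ToggleAlternating (intervalClosedSets P)) := by
  classical
  refine ⟨fun P₁ P₂ _ _ f => ?_, fun m hm => ?_, fun hP => ?_,
    toggleAlternating_of_isStronglyExtremalAtomicFree⟩
  · exact exists_toggleGroup_mulEquiv_prod f.toEquiv (mem_intervalClosedSets_iff_of_orderIso f)
      intervalClosedSets_nonempty intervalClosedSets_nonempty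
  · obtain ⟨φ, hφ⟩ := exists_toggleGroup_mulEquiv_prod
      ((Equiv.sumComm ({m}ᶜ : Set P) ({m} : Set P)).trans (Equiv.Set.sumCompl {m}))
      hm.mem_intervalClosedSets_iff intervalClosedSets_nonempty intervalClosedSets_nonempty
    refine ⟨⟨φ, hφ⟩, ?_⟩
    rw [intervalClosedSets_eq_univ_of_subsingleton (P := ({m} : Set P))] at φ
    obtain ⟨χ⟩ := nonempty_toggleGroup_univ_mulEquiv_pi (E := ({m} : Set P))
    exact ⟨φ.trans ((MulEquiv.refl _).prodCongr
      (χ.trans (MulEquiv.funUnique ({m} : Set P) (Equiv.Perm (Fin 2)))))⟩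
  · rw [hP.intervalClosedSets_eq_univ]
    exact nonempty_toggleGroup_univ_mulEquiv_pi
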